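/- Let $n\ge 1$ be an integer, let $k$ be a real number with $0\le k<n/2$, and let $\gamma\ge 0$, $\sigma>0$. Let $A\in\mathbb{R}^{n\times n}$ be an orthogonal matrix and $w\in\{\pm1\}^n$. Let $Z\in\mathbb{R}^n$ have independent coordinates, each equal to $0$ with probability $1-k/n$ and distributed as $N(0,\gamma^2)$ with probability $k/n$; let $\xi\sim N(0,\sigma^2 I)$ be independent of $Z$; and set $X=AZ+\xi$ and $Y=\langle w,Z\rangle$. (1) For every $d\ge 0$ and every real polynomial $f$ in $n$ variables of total degree at most $d$, the random variable $(f(X)-Y)^2$ is integrable and \[ \mathbb{E}\big[(f(X)-Y)^2\big]\;\ge\;\frac14\cdot\frac{\gamma^2k}{\Big(1+\sqrt{k/n}\,(d+1)^{3d+2}\big(1+(\gamma/\sigma)^d\big)\Big)^2}. \] (2) The trivial zero estimator has error $\mathbb{E}[(0-Y)^2]=\gamma^2k$. (3) Consequently, polynomials of degree $o(\log n/\log\log n)$ do no better, up to a constant factor, than the zero estimator, when the signal-to-noise ratio is at most polylogarithmic and the sparsity is polynomially smaller than $n$: let $d_n\in\mathbb{N}$, $k_n\ge0$, $\gamma_n\ge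 0$, $\sigma_n>0$ be sequences such that $d_n=o(\log n/\log\log n)$ and such that, for some constants $\varepsilon>0$ and $c\in\mathbb{R}$, $k_n\le n^{1-\varepsilon}$ and $\gamma_n/\sigma_n\le(\log n)^c$ for all large $n$. Then for every $\eta>0$ there is $n_0$ such that for all $n\ge n_0$, for the instance with parameters $(n,k_n,\gamma_n,\sigma_n)$, every orthogonal $A$, every $w\in\{\pm1\}^n$ and every polynomial $f$ of total degree at most $d_n$, \[ \mathbb{E}\big[(f(X)-Y)^2\big]\;\ge\;\Big(\frac14-\eta\Big)\,\mathbb{E}\big[(0-Y)^2\big]. \] -/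

import Mathlib

open MeasureTheory ProbabilityTheory Filter Topology Asymptotics

noncomputable section

/-- The law of one coordinate of the sparse vector: it is `0` with probability `1 - p`, and it is
distributed as `N(0, γ²)` with probability `p` (a probability measure for `0 ≤ p ≤ 1`). -/
def spikeLaw (p γ : ℝ) : Measure ℝ :=
  ENNReal.ofReal (1 - p) • Measure.dirac 0 +
    ENNReal.ofReal p • gaussianReal 0 (γ ^ 2).toNNReal

/-- The joint law of the pair `(Z, ξ)`: the coordinates of `Z` are independent, each with law
`spikeLaw (k / n) γ`; the noise `ξ` is `N(0, σ² I)`, independent of `Z`. -/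
def instanceLaw (n : ℕ) (k γ σ : ℝ) : Measure ((Fin n → ℝ) × (Fin n → ℝ)) :=
  (Measure.pi fun _ : Fin n => spikeLaw (k / n) γ).prod
    (Measure.pi fun _ : Fin n => gaussianReal 0 (σ ^ 2).toNNReal)

/-- The observation `X = A Z + ξ`. -/
def obsX {n : ℕ} (A : Matrix (Fin n) (Fin n) ℝ) (p : (Fin n → ℝ) × (Fin n → ℝ)) : Fin n → ℝ :=
  A.mulVec p.1 + p.2

/-- The target `Y = ⟨w, Z⟩`. -/
def targetY {n : ℕ} (w : Fin n → ℝ) (p : (Fin n → ℝ) × (Fin n → ℝ)) : ℝ :=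
  ∑ i, w i * p.1 i

/-- The squared error `(f(X) - Y)²` of the polynomial predictor `f`. -/
def sqError {n : ℕ} (A : Matrix (Fin n) (Fin n) ℝ) (w : Fin n → ℝ) (f : MvPolynomial (Fin n) ℝ)
    (p : (Fin n → ℝ) × (Fin n → ℝ)) : ℝ :=
  (MvPolynomial.eval (obsX A p) f - targetY w p) ^ 2

/-- The expected squared error `E[(f(X) - Y)²]`. -/
def sqLoss {n : ℕ} (k γ σ : ℝ) (A : Matrix (Fin n) (Fin n) ℝ) (w : Fin n → ℝ)
    (f : MvPolynomial (Fin n) ℝ) : ℝ :=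
  ∫ p, sqError A w f p ∂(instanceLaw n k γ σ)

end

/-!
The noise is rotation invariant, so `X` may be replaced by `Aᵀ X`, whose coordinates `Zᵢ + ξᵢ` are
independent; a linear change of variables does not change the degree of a polynomial.

For independent pairs `(Xᵢ, Zᵢ)` the target `∑ wᵢ Zᵢ` is a sum of functions of single coordinates.
The projections of the error `f(X) - Y` onto the mean-zero functions of the `i`-th pair are
pairwise orthogonal, and the `i`-th one has the form `gᵢ(Xᵢ) - wᵢ Zᵢ` with `gᵢ` a univariate
polynomial of degree at most `d`, since averaging out the other coordinates does not raise the
degree. Bessel's inequality (`exists_sum_scalar_loss_le`) therefore bounds the loss below by the sum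
of `n` scalar losses.

In the scalar problem (`scalar_loss_ge`), `g(X)` has to be small on the event `Z = 0` of probability
at least one half, where `X` is `N(0, σ²)`. A polynomial of degree `d` that is small in
`L²(N(0, σ²))` is also small in `L²(N(0, σ² + γ²))`, up to a factor depending only on `d` and
`γ / σ` (`integral_eval_add_sq_gaussianReal_le`), so `g(X)` misses most of `Z` on the event where `Z`
is Gaussian. The comparison of the two norms comes from expanding `g(z + x)` in powers of `z` and
from `v E[g'²] ≤ d E[g²]` under `N(0, v)` (`integral_derivative_sq_gaussianReal_le`), which says that
the Ornstein–Uhlenbeck operator has norm `d` on polynomials of degree at most `d`.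

In the asymptotic regime the factor depending on the degree is `n ^ o(1)`, while `√(k / n)` is at
most `n ^ (-ε / 2)` (`tendsto_loss_factor`).
-/

open scoped Polynomial NNReal

/-! ### Polynomials under a Gaussian measure -/

lemma integrable_polynomial_eval {Ω : Type*} [MeasurableSpace Ω] {μ : Measure Ω} {X : Ω → ℝ}
    (hX : ∀ m : ℕ, Integrable (fun ω => X ω ^ m) μ) (p : ℝ[X]) :
    Integrable (fun ω => p.eval (X ω)) μ := by
  simp_rw [Polynomial.eval_eq_sum_range]
  exact integrable_finsetSum _ fun i _ => (hX i).const_mul _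

lemma integrable_pow_gaussianReal (v : ℝ≥0) (m : ℕ) :
    Integrable (fun x => x ^ m) (gaussianReal 0 v) := by
  have h := (memLp_id_gaussianReal (μ := 0) (v := v) m).integrable_norm_pow' 
  refine h.mono' (by fun_prop) (ae_of_all _ fun x => by simp)

lemma integrable_eval_gaussianReal (v : ℝ≥0) (p : ℝ[X]) :
    Integrable (fun x => p.eval x) (gaussianReal 0 v) :=
  integrable_polynomial_eval (integrable_pow_gaussianReal v) p

lemma hasDerivAt_gaussianPDFReal_zero {v : ℝ≥0} (hv : v ≠ 0) (x : ℝ) :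
    HasDerivAt (gaussianPDFReal 0 v) (-(x / v) * gaussianPDFReal 0 v x) x := by
  have hv' : (v : ℝ) ≠ 0 := by exact_mod_cast hv
  have h : HasDerivAt (fun y : ℝ => -(y - 0) ^ 2 / (2 * (v : ℝ))) (-(x / v)) x := by
    have := (((hasDerivAt_id x).sub_const 0).pow 2).neg.div_const (2 * (v : ℝ))
    refine this.congr_deriv ?_
    simp only [id, Nat.cast_ofNat, sub_zero, Nat.add_one_sub_one, pow_one, mul_one]
    field_simp
  have h2 := h.exp.const_mul ((√(2 * Real.pi * v))⁻¹)
  rw [gaussianPDFReal_def]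
  exact h2.congr_deriv (by ring)

/-- Gaussian integration by parts (Stein's identity) for polynomials. -/
lemma integral_mul_eval_gaussianReal (v : ℝ≥0) (p : ℝ[X]) :
    ∫ x, x * p.eval x ∂gaussianReal 0 v = v * ∫ x, p.derivative.eval x ∂gaussianReal 0 v := by
  rcases eq_or_ne v 0 with rfl | hv
  · simp
  have hv' : (v : ℝ) ≠ 0 := by exact_mod_cast hv
  have key : ∀ q : ℝ[X], Integrable (fun x => q.eval x * gaussianPDFReal 0 v x) := by
    intro q
    have h := integrable_eval_gaussianReal v q
    rw [gaussianReal_of_var_ne_zero _ hv, integrable_withDensity_iff (measurable_gaussianPDF _ _)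
      (ae_of_all _ fun _ => gaussianPDF_lt_top)] at h
    simpa using h
  have h := integral_mul_deriv_eq_deriv_mul_of_integrable (u := fun x => p.eval x)
    (v := gaussianPDFReal 0 v) (u' := fun x => p.derivative.eval x)
    (v' := fun x => -(x / v) * gaussianPDFReal 0 v x)
    (fun x _ => p.hasDerivAt x) (fun x _ => hasDerivAt_gaussianPDFReal_zero hv x)
    (((key (Polynomial.C (-(1 / (v : ℝ))) * Polynomial.X * p))).congr
      (ae_of_all _ fun x => by simp; ring)) (key _) (key _)
  rw [integral_gaussianReal_eq_integral_smul hv, integral_gaussianReal_eq_integral_smul hv]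
  simp only [smul_eq_mul]
  have e1 : ∫ x, p.eval x * (-(x / v) * gaussianPDFReal 0 v x) =
      -(1 / (v : ℝ)) * ∫ x, gaussianPDFReal 0 v x * (x * p.eval x) := by
    rw [← integral_const_mul]
    congr 1 with x
    ring
  rw [e1] at h
  simp_rw [mul_comm (gaussianPDFReal 0 v _) (p.derivative.eval _)]
  generalize ∫ x, gaussianPDFReal 0 v x * (x * p.eval x) = I at h ⊢
  field_simp at h
  linarith

/-- A Markov-type inequality in `L²(N(0, v))`: differentiation costs at most the square root of the
degree. For the Ornstein–Uhlenbeck operator `L g = x g' - v g''`, `E[(L g) h] = v E[g' h']` and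
`(L g)' = g' + L (g')`, so `E[(L g)²] = v (E[g'²] + v E[g''²])`; the bound for `g'` and the
Cauchy–Schwarz inequality then give the bound for `g`. -/
lemma integral_derivative_sq_gaussianReal_le (v : ℝ≥0) (d : ℕ) :
    ∀ g : ℝ[X], g.natDegree ≤ d →
      v * ∫ x, g.derivative.eval x ^ 2 ∂gaussianReal 0 v ≤
        d * ∫ x, g.eval x ^ 2 ∂gaussianReal 0 v := by
  induction d with
  | zero =>
    intro g hg
    rw [Polynomial.derivative_of_natDegree_zero (by omega)]
    simp
  | succ d ih =>
    intro g hg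
    have hInt := integrable_eval_gaussianReal v
    have hE : ∀ p q : ℝ[X], ∫ x, (p + q).eval x ∂gaussianReal 0 v =
        ∫ x, p.eval x ∂gaussianReal 0 v + ∫ x, q.eval x ∂gaussianReal 0 v := fun p q => by
      simp_rw [Polynomial.eval_add]; exact integral_add (hInt p) (hInt q)
    have hC : ∀ (c : ℝ) (p : ℝ[X]), ∫ x, (Polynomial.C c * p).eval x ∂gaussianReal 0 v =
        c * ∫ x, p.eval x ∂gaussianReal 0 v := fun c p => by
      simp_rw [Polynomial.eval_mul, Polynomial.eval_C]; exact integral_const_mul _ _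
    have hX : ∀ p : ℝ[X], ∫ x, (Polynomial.X * p).eval x ∂gaussianReal 0 v =
        v * ∫ x, p.derivative.eval x ∂gaussianReal 0 v := fun p => by
      simp_rw [Polynomial.eval_mul, Polynomial.eval_X]; exact integral_mul_eval_gaussianReal v p
    set E : ℝ[X] → ℝ := fun p => ∫ x, p.eval x ∂gaussianReal 0 v with hEdef
    have hsq : ∀ p : ℝ[X], ∫ x, p.eval x ^ 2 ∂gaussianReal 0 v = E (p * p) := fun p => by
      simp [hEdef, sq]
    change ∀ p q : ℝ[X], E (p + q) = E p + E q at hE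
    change ∀ (c : ℝ) (p : ℝ[X]), E (Polynomial.C c * p) = c * E p at hC
    change ∀ p : ℝ[X], E (Polynomial.X * p) = v * E p.derivative at hX
    have hnn : ∀ p : ℝ[X], 0 ≤ E (p * p) := fun p => by
      rw [← hsq]; exact integral_nonneg fun x => sq_nonneg _
    -- the Ornstein–Uhlenbeck operator, and its Dirichlet form
    let T : ℝ[X] → ℝ[X] := fun p =>
      Polynomial.X * p.derivative + Polynomial.C (-(v : ℝ)) * p.derivative.derivative
    have hT : ∀ p q : ℝ[X], E (T p * q) = v * E (p.derivative * q.derivative) := fun p q => by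
      have h1 : T p * q = Polynomial.X * (p.derivative * q) +
          Polynomial.C (-(v : ℝ)) * (p.derivative.derivative * q) := by
        simp only [T]; ring
      rw [h1, hE, hX, hC, Polynomial.derivative_mul, hE]
      ring
    have hT' : ∀ p : ℝ[X], (T p).derivative = p.derivative + T p.derivative := fun p => by
      simp [T]; ring
    have hb := ih g.derivative ((Polynomial.natDegree_derivative_le g).trans (by omega))
    rw [hsq, hsq] at hb ⊢
    have hTT : E (T g * T g) ≤ v * ((d + 1) * E (g.derivative * g.derivative)) := by
      rw [hT, hT', mul_add, hE, mul_comm g.derivative (T g.derivative), hT]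
      gcongr
      linarith
    have hTg := hT g g
    have h0 := hnn g
    have h1 := hnn g.derivative
    -- Cauchy–Schwarz, from the nonnegativity of `E[(s T g - t g)²]`
    have hCS : ∀ s t : ℝ,
        0 ≤ s ^ 2 * E (T g * T g) - 2 * s * t * E (T g * g) + t ^ 2 * E (g * g) := by
      intro s t
      have := hnn (Polynomial.C s * T g + Polynomial.C (-t) * g)
      have e : (Polynomial.C s * T g + Polynomial.C (-t) * g) *
          (Polynomial.C s * T g + Polynomial.C (-t) * g) =
          Polynomial.C (s ^ 2) * (T g * T g) + (Polynomial.C (-(2 * s * t)) * (T g * g) +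
            Polynomial.C (t ^ 2) * (g * g)) := by
        simp only [Polynomial.C_neg, Polynomial.C_mul, Polynomial.C_pow,
          map_ofNat]
        ring
      rw [e, hE, hE, hC, hC, hC] at this
      linarith
    -- `t / s = d + 1` is the largest possible value of the Rayleigh quotient of `T`
    have := hCS 1 (d + 1)
    push_cast
    have hd : (0 : ℝ) < d + 1 := by positivity
    have h5 : (d + 1) * (v * E (g.derivative * g.derivative)) ≤
        (d + 1) * ((d + 1) * E (g * g)) := by
      nlinarith
    exact le_of_mul_le_mul_left h5 hd

/-- The Markov-type inequality, iterated: `g.hasseDeriv j` is the `j`-th derivative of `g` divided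
by `j!`, that is, the `j`-th Taylor coefficient of `g` as a polynomial in the base point. -/
lemma integral_hasseDeriv_sq_gaussianReal_le (v : ℝ≥0) {d : ℕ} {g : ℝ[X]} (hg : g.natDegree ≤ d)
    (j : ℕ) :
    v ^ j * (j.factorial : ℝ) ^ 2 * ∫ x, (g.hasseDeriv j).eval x ^ 2 ∂gaussianReal 0 v ≤
      d ^ j * ∫ x, g.eval x ^ 2 ∂gaussianReal 0 v := by
  induction j with
  | zero => simp
  | succ j ih =>
    have hdeg : (g.hasseDeriv j).natDegree ≤ d :=
      (Polynomial.natDegree_hasseDeriv_le g j).trans (by omega)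
    have h := integral_derivative_sq_gaussianReal_le v d _ hdeg
    have e : (g.hasseDeriv j).derivative = Polynomial.C ((j : ℝ) + 1) * g.hasseDeriv (j + 1) := by
      have := congrArg (fun L => L g) (Polynomial.hasseDeriv_comp (R := ℝ) 1 j)
      simp only [LinearMap.comp_apply, Polynomial.hasseDeriv_one, LinearMap.smul_apply] at this
      rw [this, add_comm 1 j, Nat.choose_one_right, nsmul_eq_mul]
      simp
    rw [e] at h
    simp only [Polynomial.eval_mul, Polynomial.eval_C, mul_pow, integral_const_mul] at h
    rw [Nat.factorial_succ, pow_succ, pow_succ (d : ℝ)]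
    push_cast
    have hc : (0 : ℝ) ≤ v ^ j * (j.factorial : ℝ) ^ 2 := by positivity
    have h2 := mul_le_mul_of_nonneg_left h hc
    have h3 := mul_le_mul_of_nonneg_left ih (Nat.cast_nonneg (α := ℝ) d)
    nlinarith

/-- The even moments, `(2j - 1)!! uʲ`, are at most `2ʲ j! uʲ`. -/
lemma integral_pow_even_gaussianReal_le (u : ℝ≥0) (j : ℕ) :
    ∫ x, x ^ (2 * j) ∂gaussianReal 0 u ≤ 2 ^ j * j.factorial * u ^ j := by
  induction j with
  | zero => simp
  | succ j ih =>
    have h := integral_mul_eval_gaussianReal u (Polynomial.X ^ (2 * j + 1))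
    have e : ∀ x : ℝ, x ^ (2 * (j + 1)) = x * (Polynomial.X ^ (2 * j + 1) : ℝ[X]).eval x := by
      intro x; simp; ring
    simp_rw [e, h]
    simp only [Polynomial.derivative_X_pow, Polynomial.eval_mul, Polynomial.eval_pow,
      Polynomial.eval_X, Polynomial.eval_C, Nat.add_sub_cancel, integral_const_mul]
    rw [Nat.factorial_succ]
    push_cast
    have h0 : 0 ≤ ∫ x, x ^ (2 * j) ∂gaussianReal 0 u :=
      integral_nonneg fun x => by rw [pow_mul]; positivity
    calc (u : ℝ) * ((2 * j + 1) * ∫ x, x ^ (2 * j) ∂gaussianReal 0 u)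
        ≤ u * ((2 * j + 2) * (2 ^ j * j.factorial * u ^ j)) := by gcongr; norm_num
      _ = _ := by ring

lemma integrable_add_pow_prod {μ ν : Measure ℝ} [SFinite μ] [SFinite ν]
    (hμ : ∀ m : ℕ, Integrable (fun x => x ^ m) μ) (hν : ∀ m : ℕ, Integrable (fun x => x ^ m) ν)
    (m : ℕ) : Integrable (fun q : ℝ × ℝ => (q.1 + q.2) ^ m) (μ.prod ν) := by
  simp_rw [add_pow]
  exact integrable_finsetSum _ fun i _ => ((hμ i).mul_prod (hν (m - i))).mul_const _

lemma memLp_two_polynomial_eval {Ω : Type*} [MeasurableSpace Ω] {μ : Measure Ω} {X : Ω → ℝ}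
    (hX : ∀ m : ℕ, Integrable (fun ω => X ω ^ m) μ) (p : ℝ[X]) :
    MemLp (fun ω => p.eval (X ω)) 2 μ := by
  refine (memLp_two_iff_integrable_sq (integrable_polynomial_eval hX p).aestronglyMeasurable).2 ?_
  exact (integrable_polynomial_eval hX (p ^ 2)).congr
    (ae_of_all _ fun _ => Polynomial.eval_pow 2)

/-- Adding an independent `N(0, u)` variable to an `N(0, v)` variable changes the second moment of
a polynomial `g` of degree at most `d` by a bounded factor: expand `g (z + x)` in powers of `z`. -/
lemma integral_eval_add_sq_gaussianReal_le {u v : ℝ≥0} (hv : v ≠ 0) {d : ℕ} {g : ℝ[X]}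
    (hg : g.natDegree ≤ d) :
    ∫ q : ℝ × ℝ, g.eval (q.1 + q.2) ^ 2 ∂(gaussianReal 0 u).prod (gaussianReal 0 v) ≤
      (2 * (d + 1) * ∑ j ∈ Finset.range (d + 1), (u / v * d : ℝ) ^ j) *
        ∫ x, g.eval x ^ 2 ∂gaussianReal 0 v := by
  have hv' : (0 : ℝ) < v := by positivity
  have hexp : ∀ q : ℝ × ℝ, g.eval (q.1 + q.2) =
      ∑ j ∈ Finset.range (d + 1), (g.hasseDeriv j).eval q.2 * q.1 ^ j := fun q => by
    rw [← Polynomial.taylor_eval, Polynomial.eval_eq_sum_range' (n := d + 1)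
      (by rw [Polynomial.natDegree_taylor]; omega)]
    simp_rw [Polynomial.taylor_coeff]
  have hI : ∀ j : ℕ, Integrable (fun q : ℝ × ℝ => q.1 ^ (2 * j) * (g.hasseDeriv j).eval q.2 ^ 2)
      ((gaussianReal 0 u).prod (gaussianReal 0 v)) := fun j => by
    refine (integrable_pow_gaussianReal u (2 * j)).mul_prod
      (g := fun x => (g.hasseDeriv j).eval x ^ 2) ?_
    exact (integrable_eval_gaussianReal v (g.hasseDeriv j ^ 2)).congr
      (ae_of_all _ fun _ => Polynomial.eval_pow 2)
  calc ∫ q : ℝ × ℝ, g.eval (q.1 + q.2) ^ 2 ∂(gaussianReal 0 u).prod (gaussianReal 0 v)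
      ≤ ∫ q : ℝ × ℝ, ((d : ℝ) + 1) * ∑ j ∈ Finset.range (d + 1),
          q.1 ^ (2 * j) * (g.hasseDeriv j).eval q.2 ^ 2
          ∂(gaussianReal 0 u).prod (gaussianReal 0 v) := by
        refine integral_mono_of_nonneg (ae_of_all _ fun q => sq_nonneg _)
          ((integrable_finsetSum _ fun j _ => hI j).const_mul _) (ae_of_all _ fun q => ?_)
        beta_reduce
        rw [hexp]
        refine (sq_sum_le_card_mul_sum_sq ..).trans (le_of_eq ?_)
        rw [Finset.card_range]
        push_cast
        congr 1
        exact Finset.sum_congr rfl fun j _ => by ring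
    _ = (d + 1) * ∑ j ∈ Finset.range (d + 1), (∫ z, z ^ (2 * j) ∂gaussianReal 0 u) *
          ∫ x, (g.hasseDeriv j).eval x ^ 2 ∂gaussianReal 0 v := by
        rw [integral_const_mul, integral_finsetSum _ fun j _ => hI j]
        congr 1
        exact Finset.sum_congr rfl fun j _ => integral_prod_mul (μ := gaussianReal 0 u)
          (ν := gaussianReal 0 v) (fun z : ℝ => z ^ (2 * j))
          (fun x => (g.hasseDeriv j).eval x ^ 2)
    _ ≤ (d + 1) * ∑ j ∈ Finset.range (d + 1), 2 * (u / v * d : ℝ) ^ j *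
          ∫ x, g.eval x ^ 2 ∂gaussianReal 0 v := by
        refine mul_le_mul_of_nonneg_left (Finset.sum_le_sum fun j _ => ?_) (by positivity)
        have h1 := integral_pow_even_gaussianReal_le u j
        have h2 := integral_hasseDeriv_sq_gaussianReal_le v hg j
        set M := ∫ z, z ^ (2 * j) ∂gaussianReal 0 u
        set H := ∫ x, (g.hasseDeriv j).eval x ^ 2 ∂gaussianReal 0 v
        set G := ∫ x, g.eval x ^ 2 ∂gaussianReal 0 v
        have hH : 0 ≤ H := integral_nonneg fun x => sq_nonneg _
        have hfac : (0 : ℝ) < j.factorial := by positivity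
        have h2j : (2 : ℝ) ^ j ≤ 2 * j.factorial := by
          have : 2 ^ j ≤ 2 * j.factorial := by
            rcases j with _ | j
            · simp
            · rw [pow_succ, mul_comm]
              gcongr
              simpa [add_comm] using Nat.factorial_mul_pow_le_factorial (m := 1) (n := j)
          exact_mod_cast this
        calc M * H ≤ (2 ^ j * j.factorial * u ^ j) * H := by gcongr
          _ ≤ (2 * j.factorial * j.factorial * u ^ j) * H := by gcongr
          _ = 2 * (u / v : ℝ) ^ j * (v ^ j * (j.factorial : ℝ) ^ 2 * H) := by
            rw [div_pow]; field_simp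
          _ ≤ 2 * (u / v : ℝ) ^ j * (d ^ j * G) := by gcongr
          _ = _ := by rw [mul_pow]; ring
    _ = _ := by rw [← Finset.sum_mul, ← Finset.mul_sum]; ring

/-- With `ρ = γ / σ`, the factor in `integral_eval_add_sq_gaussianReal_le` is at most twice the
square of the factor in the main bound. -/
lemma geom_sum_sq_mul_le {ρ : ℝ} (hρ : 0 ≤ ρ) (d : ℕ) :
    2 * ((d : ℝ) + 1) * ∑ j ∈ Finset.range (d + 1), (ρ ^ 2 * d) ^ j ≤
      2 * (((d : ℝ) + 1) ^ (3 * d + 2) * (1 + ρ ^ d)) ^ 2 := by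
  have h1 : (1 : ℝ) ≤ d + 1 := by linarith [Nat.cast_nonneg (α := ℝ) d]
  have hterm : ∀ j ∈ Finset.range (d + 1),
      (ρ ^ 2 * d) ^ j ≤ (1 + ρ ^ d) ^ 2 * ((d : ℝ) + 1) ^ d := by
    intro j hj
    have hjd : j ≤ d := Finset.mem_range_succ_iff.1 hj
    have hr : ρ ^ j ≤ 1 + ρ ^ d := by
      rcases le_total ρ 1 with h | h
      · linarith [pow_le_one₀ (n := j) hρ h, pow_nonneg hρ d]
      · linarith [pow_le_pow_right₀ h hjd]
    calc (ρ ^ 2 * d) ^ j = (ρ ^ j) ^ 2 * (d : ℝ) ^ j := by ring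
      _ ≤ (1 + ρ ^ d) ^ 2 * ((d : ℝ) + 1) ^ j := by gcongr; linarith
      _ ≤ _ := by gcongr
  have hsum := Finset.sum_le_card_nsmul _ _ _ hterm
  rw [Finset.card_range, nsmul_eq_mul] at hsum
  push_cast at hsum
  calc 2 * ((d : ℝ) + 1) * ∑ j ∈ Finset.range (d + 1), (ρ ^ 2 * d) ^ j
      ≤ 2 * ((d : ℝ) + 1) * ((d + 1) * ((1 + ρ ^ d) ^ 2 * ((d : ℝ) + 1) ^ d)) := by gcongr
    _ = 2 * (1 + ρ ^ d) ^ 2 * ((d : ℝ) + 1) ^ (d + 2) := by ring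
    _ ≤ 2 * (1 + ρ ^ d) ^ 2 * ((d : ℝ) + 1) ^ ((3 * d + 2) * 2) := by
      gcongr
      omega
    _ = _ := by ring

/-! ### The scalar problem -/

/-- The atom at zero is the degenerate Gaussian `N(0, 0)`, so that facts about Gaussian measures
apply to both parts of the mixture. -/
lemma spikeLaw_eq (p γ : ℝ) : spikeLaw p γ = ENNReal.ofReal (1 - p) • gaussianReal 0 0 +
    ENNReal.ofReal p • gaussianReal 0 (γ ^ 2).toNNReal := by
  rw [spikeLaw, gaussianReal_zero_var]

lemma isProbabilityMeasure_spikeLaw {p : ℝ} (h0 : 0 ≤ p) (h1 : p ≤ 1) (γ : ℝ) :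
    IsProbabilityMeasure (spikeLaw p γ) := by
  constructor
  simp only [spikeLaw, Measure.add_apply, Measure.smul_apply, measure_univ, smul_eq_mul, mul_one]
  rw [← ENNReal.ofReal_add (by linarith) h0]
  simp

lemma integrable_pow_spikeLaw (p γ : ℝ) (m : ℕ) :
    Integrable (fun x => x ^ m) (spikeLaw p γ) := by
  rw [spikeLaw_eq]
  exact ((integrable_pow_gaussianReal _ m).smul_measure ENNReal.ofReal_ne_top).add_measure
    ((integrable_pow_gaussianReal _ m).smul_measure ENNReal.ofReal_ne_top)

lemma integral_spikeLaw_prod {p : ℝ} (h0 : 0 ≤ p) (h1 : p ≤ 1) (γ : ℝ) {v : ℝ≥0} {h : ℝ × ℝ → ℝ}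
    (hh : ∀ u, Integrable h ((gaussianReal 0 u).prod (gaussianReal 0 v))) :
    ∫ q, h q ∂(spikeLaw p γ).prod (gaussianReal 0 v) =
      (1 - p) * ∫ x, h (0, x) ∂gaussianReal 0 v +
        p * ∫ q, h q ∂(gaussianReal 0 (γ ^ 2).toNNReal).prod (gaussianReal 0 v) := by
  rw [spikeLaw_eq, Measure.add_prod, Measure.prod_smul_left, Measure.prod_smul_left,
    integral_add_measure ((hh _).smul_measure ENNReal.ofReal_ne_top)
      ((hh _).smul_measure ENNReal.ofReal_ne_top), integral_smul_measure, integral_smul_measure,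
    ENNReal.toReal_ofReal (by linarith), ENNReal.toReal_ofReal h0, integral_prod _ (hh 0)]
  simp

lemma integral_sq_gaussianReal (u : ℝ≥0) : ∫ x, x ^ 2 ∂gaussianReal 0 u = u := by
  have := integral_mul_eval_gaussianReal u Polynomial.X
  simpa [sq] using this

lemma integral_id_spikeLaw (p γ : ℝ) : ∫ x, x ∂spikeLaw p γ = 0 := by
  have h : ∀ u, Integrable (fun x : ℝ => x) (gaussianReal 0 u) := fun u => by
    simpa using integrable_pow_gaussianReal u 1
  rw [spikeLaw_eq, integral_add_measure ((h _).smul_measure ENNReal.ofReal_ne_top)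
    ((h _).smul_measure ENNReal.ofReal_ne_top), integral_smul_measure, integral_smul_measure]
  simp

lemma integral_sq_spikeLaw {p : ℝ} (h0 : 0 ≤ p) (γ : ℝ) :
    ∫ x, x ^ 2 ∂spikeLaw p γ = p * γ ^ 2 := by
  have h : ∀ u, Integrable (fun x : ℝ => x ^ 2) (gaussianReal 0 u) := fun u =>
    integrable_pow_gaussianReal u 2
  rw [spikeLaw_eq, integral_add_measure ((h _).smul_measure ENNReal.ofReal_ne_top)
    ((h _).smul_measure ENNReal.ofReal_ne_top), integral_smul_measure, integral_smul_measure,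
    integral_sq_gaussianReal, integral_sq_gaussianReal, ENNReal.toReal_ofReal h0]
  simp [sq_nonneg]

lemma integrable_eval_add_sub_sq {μ ν : Measure ℝ} [IsFiniteMeasure μ] [IsFiniteMeasure ν]
    (hμ : ∀ m : ℕ, Integrable (fun x => x ^ m) μ) (hν : ∀ m : ℕ, Integrable (fun x => x ^ m) ν)
    (g : ℝ[X]) :
    Integrable (fun q : ℝ × ℝ => (g.eval (q.1 + q.2) - q.1) ^ 2) (μ.prod ν) := by
  have h1 := memLp_two_polynomial_eval (μ := μ.prod ν) (X := fun q : ℝ × ℝ => q.1 + q.2)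
    (integrable_add_pow_prod hμ hν) g
  have h2 := memLp_two_polynomial_eval (μ := μ.prod ν) (X := fun q : ℝ × ℝ => q.1)
    (fun m => (hμ m).comp_fst ν) Polynomial.X
  simpa using (h1.sub h2).integrable_sq

/-- The lower bound for a single coordinate. If `g` is a good predictor on the event `Z = 0`, then
`E[g(ξ)²]` is small; hence so is `E[g(Z + ξ)²]` on the event where `Z` is Gaussian, and there
`g(Z + ξ)` misses most of `Z`. -/
lemma scalar_loss_ge {p γ σ : ℝ} (h0 : 0 ≤ p) (h1 : p ≤ 1 / 2) (hγ : 0 ≤ γ) (hσ : 0 < σ) {d : ℕ}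
    {g : ℝ[X]} (hg : g.natDegree ≤ d) :
    (1 / 4 : ℝ) * (γ ^ 2 * p /
      (1 + √p * ((d : ℝ) + 1) ^ (3 * d + 2) * (1 + (γ / σ) ^ d)) ^ 2) ≤
    ∫ q : ℝ × ℝ, (g.eval (q.1 + q.2) - q.1) ^ 2
      ∂(spikeLaw p γ).prod (gaussianReal 0 (σ ^ 2).toNNReal) := by
  set v : ℝ≥0 := (σ ^ 2).toNNReal with hv
  set u : ℝ≥0 := (γ ^ 2).toNNReal with hu
  have hvr : (v : ℝ) = σ ^ 2 := Real.coe_toNNReal _ (sq_nonneg _)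
  have hur : (u : ℝ) = γ ^ 2 := Real.coe_toNNReal _ (sq_nonneg _)
  have hv0 : v ≠ 0 := by
    intro h; rw [h] at hvr; have : 0 < σ ^ 2 := by positivity
    simp at hvr; linarith
  have hI : ∀ u' : ℝ≥0, Integrable (fun q : ℝ × ℝ => (g.eval (q.1 + q.2) - q.1) ^ 2)
      ((gaussianReal 0 u').prod (gaussianReal 0 v)) := fun u' =>
    integrable_eval_add_sub_sq (integrable_pow_gaussianReal u') (integrable_pow_gaussianReal v) g
  have hIg : Integrable (fun q : ℝ × ℝ => g.eval (q.1 + q.2) ^ 2)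
      ((gaussianReal 0 u).prod (gaussianReal 0 v)) :=
    (memLp_two_polynomial_eval (integrable_add_pow_prod (integrable_pow_gaussianReal u)
      (integrable_pow_gaussianReal v)) g).integrable_sq
  rw [integral_spikeLaw_prod h0 (by linarith) γ hI]
  simp only [zero_add, sub_zero]
  rw [← hu]
  set C : ℝ := ((d : ℝ) + 1) ^ (3 * d + 2) * (1 + (γ / σ) ^ d) with hC
  have hC0 : 0 ≤ C := by positivity
  have hS : ∫ q : ℝ × ℝ, g.eval (q.1 + q.2) ^ 2 ∂(gaussianReal 0 u).prod (gaussianReal 0 v) ≤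
      2 * C ^ 2 * ∫ x, g.eval x ^ 2 ∂gaussianReal 0 v := by
    refine (integral_eval_add_sq_gaussianReal_le hv0 hg).trans ?_
    have hρ := geom_sum_sq_mul_le (ρ := γ / σ) (by positivity) d
    rw [hur, hvr, ← div_pow]
    have : 0 ≤ ∫ x, g.eval x ^ 2 ∂gaussianReal 0 v := integral_nonneg fun x => sq_nonneg _
    gcongr
  have hA : 0 ≤ ∫ x, g.eval x ^ 2 ∂gaussianReal 0 v := integral_nonneg fun x => sq_nonneg _
  have hB : 0 ≤ ∫ q : ℝ × ℝ, (g.eval (q.1 + q.2) - q.1) ^ 2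
      ∂(gaussianReal 0 u).prod (gaussianReal 0 v) := integral_nonneg fun x => sq_nonneg _
  -- the choice of `t` balances the two error terms
  set s : ℝ := √p * C with hs
  have hs0 : 0 ≤ s := by positivity
  have hs2 : s ^ 2 = p * C ^ 2 := by rw [hs, mul_pow, Real.sq_sqrt h0]
  obtain ⟨t, ht⟩ : ∃ t, t = 1 + 2 * s := ⟨_, rfl⟩
  have ht0 : 0 < t := by linarith
  have hZ : γ ^ 2 ≤ (1 + t) * ∫ q : ℝ × ℝ, (g.eval (q.1 + q.2) - q.1) ^ 2
      ∂(gaussianReal 0 u).prod (gaussianReal 0 v) + (1 + 1 / t) *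
      ∫ q : ℝ × ℝ, g.eval (q.1 + q.2) ^ 2 ∂(gaussianReal 0 u).prod (gaussianReal 0 v) := by
    have e : ∫ q : ℝ × ℝ, q.1 ^ 2 ∂(gaussianReal 0 u).prod (gaussianReal 0 v) = γ ^ 2 := by
      have := integral_fun_fst (μ := gaussianReal 0 u) (ν := gaussianReal 0 v)
        (fun z : ℝ => z ^ 2)
      rw [this, integral_sq_gaussianReal]
      simp [hur]
    rw [← e, ← integral_const_mul, ← integral_const_mul,
      ← integral_add ((hI u).const_mul _) (hIg.const_mul _)]
    refine integral_mono_of_nonneg (ae_of_all _ fun q => sq_nonneg _)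
      (((hI u).const_mul _).add (hIg.const_mul _)) (ae_of_all _ fun q => ?_)
    beta_reduce
    generalize g.eval (q.1 + q.2) = y
    have : (1 + t) * (y - q.1) ^ 2 + (1 + 1 / t) * y ^ 2 - q.1 ^ 2 =
        (t * (y - q.1) + y) ^ 2 / t := by field_simp; ring
    have h3 : 0 ≤ (t * (y - q.1) + y) ^ 2 / t := by positivity
    linarith
  rw [show √p * ((d : ℝ) + 1) ^ (3 * d + 2) * (1 + (γ / σ) ^ d) = s by rw [hs, hC]; ring]
  set S := ∫ q : ℝ × ℝ, g.eval (q.1 + q.2) ^ 2 ∂(gaussianReal 0 u).prod (gaussianReal 0 v)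
  set B := ∫ q : ℝ × ℝ, (g.eval (q.1 + q.2) - q.1) ^ 2
      ∂(gaussianReal 0 u).prod (gaussianReal 0 v)
  set a := ∫ x, g.eval x ^ 2 ∂gaussianReal 0 v
  have hts : (1 + 1 / t) * (4 * s ^ 2) ≤ 4 * (1 + s) ^ 2 := by
    have : 1 / t * (4 * s ^ 2) ≤ 2 * s := by
      rw [ht, one_div, inv_mul_le_iff₀ (by linarith)]; nlinarith
    nlinarith
  have key : γ ^ 2 * p ≤ 4 * (1 + s) ^ 2 * ((1 - p) * a + p * B) := by
    calc γ ^ 2 * p ≤ ((1 + t) * B + (1 + 1 / t) * (2 * C ^ 2 * a)) * p := by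
          gcongr
          exact hZ.trans (by gcongr)
      _ = (1 + t) * (p * B) + (1 + 1 / t) * (4 * s ^ 2) * (1 / 2 * a) := by rw [hs2]; ring
      _ ≤ 4 * (1 + s) ^ 2 * (p * B) + 4 * (1 + s) ^ 2 * ((1 - p) * a) := by
          gcongr
          · nlinarith
          · linarith
      _ = _ := by ring
  rw [← mul_div_assoc, div_le_iff₀ (by positivity)]
  linarith

/-! ### Tensorization -/

lemma MeasureTheory.MemLp.integrable_fun_mul {Ω : Type*} [MeasurableSpace Ω] {μ : Measure Ω}
    {f g : Ω → ℝ} (hf : MemLp f 2 μ) (hg : MemLp g 2 μ) : Integrable (fun a => f a * g a) μ :=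
  hf.integrable_mul hg

section ProductSpace

variable {ι Ω : Type*} [Fintype ι] [MeasurableSpace Ω] {ν : Measure Ω} {X Z : Ω → ℝ}

lemma integrable_mvPolynomial_eval_pi [SigmaFinite ν]
    (hX : ∀ m : ℕ, Integrable (fun a => X a ^ m) ν) (f : MvPolynomial ι ℝ) :
    Integrable (fun ω : ι → Ω => MvPolynomial.eval (fun j => X (ω j)) f)
      (Measure.pi fun _ => ν) := by
  simp_rw [MvPolynomial.eval_eq']
  exact integrable_finsetSum _ fun s _ =>
    (Integrable.fintype_prod (f := fun j a => X a ^ s j) fun j => hX (s j)).const_mul _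

lemma memLp_two_mvPolynomial_eval_pi [SigmaFinite ν]
    (hX : ∀ m : ℕ, Integrable (fun a => X a ^ m) ν) (f : MvPolynomial ι ℝ) :
    MemLp (fun ω : ι → Ω => MvPolynomial.eval (fun j => X (ω j)) f) 2 (Measure.pi fun _ => ν) := by
  refine (memLp_two_iff_integrable_sq
    (integrable_mvPolynomial_eval_pi hX f).aestronglyMeasurable).2 ?_
  exact (integrable_mvPolynomial_eval_pi hX (f ^ 2)).congr (ae_of_all _ fun _ => by simp)

lemma memLp_two_comp_eval_pi [IsProbabilityMeasure ν] {φ : Ω → ℝ} (hφ : MemLp φ 2 ν) (i : ι) :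
    MemLp (fun ω : ι → Ω => φ (ω i)) 2 (Measure.pi fun _ => ν) :=
  hφ.comp_measurePreserving (measurePreserving_eval (fun _ : ι => ν) i)

lemma integral_comp_eval_mul_comp_eval_pi [IsProbabilityMeasure ν] {φ ψ : Ω → ℝ}
    (hφ : AEStronglyMeasurable φ ν) (hψ : AEStronglyMeasurable ψ ν) {i j : ι} (hij : i ≠ j) :
    ∫ ω : ι → Ω, φ (ω i) * ψ (ω j) ∂(Measure.pi fun _ => ν) = (∫ a, φ a ∂ν) * ∫ a, ψ a ∂ν := by
  have hind : IndepFun (fun ω : ι → Ω => ω i) (fun ω => ω j) (Measure.pi fun _ => ν) :=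
    (iIndepFun_pi (μ := fun _ : ι => ν) (X := fun _ a => a) fun _ => aemeasurable_id).indepFun hij
  have hmp := fun i : ι => (measurePreserving_eval (fun _ : ι => ν) i).map_eq
  rw [hind.integral_fun_comp_mul_comp (measurable_pi_apply i).aemeasurable
    (measurable_pi_apply j).aemeasurable (by rw [← hmp i] at hφ; exact hφ)
    (by rw [← hmp j] at hψ; exact hψ), integral_comp_eval hφ, integral_comp_eval hψ]

/-- Averaging out all the coordinates but the `i`-th turns a polynomial of degree `d` into a
univariate polynomial of degree at most `d`. -/
lemma exists_polynomial_integral_mul_pi [IsProbabilityMeasure ν]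
    (hX : ∀ m : ℕ, Integrable (fun a => X a ^ m) ν) (f : MvPolynomial ι ℝ) (i : ι) :
    ∃ h : ℝ[X], h.natDegree ≤ f.totalDegree ∧ ∀ φ : Ω → ℝ, MemLp φ 2 ν →
      ∫ ω : ι → Ω, MvPolynomial.eval (fun j => X (ω j)) f * φ (ω i) ∂(Measure.pi fun _ => ν) =
        ∫ a, h.eval (X a) * φ a ∂ν := by
  classical
  refine ⟨∑ s ∈ f.support, Polynomial.monomial (s i)
    (f.coeff s * ∏ j ∈ Finset.univ.erase i, ∫ a, X a ^ s j ∂ν), ?_, fun φ hφ => ?_⟩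
  · refine Polynomial.natDegree_sum_le_of_forall_le _ _ fun s hs =>
      (Polynomial.natDegree_monomial_le _).trans ?_
    refine le_trans ?_ (MvPolynomial.le_totalDegree hs)
    rw [Finsupp.sum_fintype _ _ fun _ => rfl]
    exact Finset.single_le_sum (fun _ _ => Nat.zero_le _) (Finset.mem_univ i)
  · have hXφ : ∀ m : ℕ, Integrable (fun a => X a ^ m * φ a) ν := fun m => by
      have := memLp_two_polynomial_eval hX (Polynomial.X ^ m)
      simp only [Polynomial.eval_pow, Polynomial.eval_X] at this
      exact this.integrable_fun_mul hφ
    -- the factor `φ (ω i)` is absorbed into the `i`-th factor of the monomial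
    let F : (ι →₀ ℕ) → ι → Ω → ℝ := fun s j a => if j = i then X a ^ s i * φ a else X a ^ s j
    have hFint : ∀ s j, Integrable (F s j) ν := fun s j => by
      by_cases h : j = i
      · simpa only [F, h, if_true] using hXφ (s i)
      · simpa only [F, h, if_false] using hX (s j)
    have hF : ∀ s (ω : ι → Ω), (∏ j, X (ω j) ^ s j) * φ (ω i) = ∏ j, F s j (ω j) := by
      intro s ω
      rw [← Finset.mul_prod_erase _ _ (Finset.mem_univ i),
        ← Finset.mul_prod_erase _ (fun j => F s j (ω j)) (Finset.mem_univ i)]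
      have : ∏ j ∈ Finset.univ.erase i, F s j (ω j) =
          ∏ j ∈ Finset.univ.erase i, X (ω j) ^ s j :=
        Finset.prod_congr rfl fun j hj => by simp [F, Finset.ne_of_mem_erase hj]
      rw [this]
      simp only [F, if_true]
      ring
    have hF' : ∀ s, ∏ j, ∫ a, F s j a ∂ν =
        (∫ a, X a ^ s i * φ a ∂ν) * ∏ j ∈ Finset.univ.erase i, ∫ a, X a ^ s j ∂ν := by
      intro s
      rw [← Finset.mul_prod_erase _ _ (Finset.mem_univ i)]
      congr 1
      · simp [F]
      · exact Finset.prod_congr rfl fun j hj => by simp [F, Finset.ne_of_mem_erase hj]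
    simp_rw [MvPolynomial.eval_eq', Finset.sum_mul, mul_assoc, hF, Polynomial.eval_finsetSum,
      Polynomial.eval_monomial, Finset.sum_mul]
    rw [integral_finsetSum _ fun s _ => (Integrable.fintype_prod (hFint s)).const_mul _,
      integral_finsetSum _ fun s _ => ?_]
    · refine Finset.sum_congr rfl fun s _ => ?_
      simp_rw [mul_assoc]
      rw [integral_const_mul, integral_const_mul, integral_const_mul,
        integral_fintype_prod_eq_prod, hF']
      ring
    · simp_rw [mul_assoc]
      exact ((hXφ (s i)).const_mul _).const_mul _

/-- Tensorization. Predicting `∑ wᵢ Zᵢ` from independent copies of `X` by a polynomial of degree at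
most `d` costs at least as much as predicting each `Zᵢ` from the single `Xᵢ`: this is Bessel's
inequality for the projections of the error onto the functions of one coordinate of mean zero,
which are pairwise orthogonal. -/
lemma exists_sum_scalar_loss_le [IsProbabilityMeasure ν]
    (hX : ∀ m : ℕ, Integrable (fun a => X a ^ m) ν) (hZ : MemLp Z 2 ν) (hZ0 : ∫ a, Z a ∂ν = 0)
    {w : ι → ℝ} (hw : ∀ i, w i = 1 ∨ w i = -1) (f : MvPolynomial ι ℝ) :
    ∃ g : ι → ℝ[X], (∀ i, (g i).natDegree ≤ f.totalDegree) ∧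
      ∑ i, ∫ a, ((g i).eval (X a) - Z a) ^ 2 ∂ν ≤
        ∫ ω : ι → Ω, (MvPolynomial.eval (fun j => X (ω j)) f - ∑ j, w j * Z (ω j)) ^ 2
          ∂(Measure.pi fun _ => ν) := by
  choose h hdeg hint using exists_polynomial_integral_mul_pi hX f
  -- centring `h i` makes `r i` orthogonal to the constants, hence to every `r j` and `Z j`, `j ≠ i`
  let c : ι → ℝ := fun i => ∫ a, (h i).eval (X a) ∂ν
  let r : ι → Ω → ℝ := fun i a => (h i).eval (X a) - c i - w i * Z a
  have hhL : ∀ i, MemLp (fun a => (h i).eval (X a)) 2 ν := fun i =>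
    memLp_two_polynomial_eval hX (h i)
  have hrL : ∀ i, MemLp (r i) 2 ν := fun i =>
    ((hhL i).sub (memLp_const (c i))).sub (hZ.const_mul (w i))
  have hr0 : ∀ i, ∫ a, r i a ∂ν = 0 := fun i => by
    have hsub : Integrable (fun a => (h i).eval (X a) - c i) ν :=
      ((hhL i).integrable one_le_two).sub (integrable_const _)
    simp only [r]
    rw [integral_sub hsub ((hZ.integrable one_le_two).const_mul _),
      integral_sub ((hhL i).integrable one_le_two)
      (integrable_const _), integral_const_mul, hZ0]
    simp [c]
  refine ⟨fun i => Polynomial.C (w i) * (h i - Polynomial.C (c i)), fun i => ?_, ?_⟩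
  · refine (Polynomial.natDegree_C_mul_le _ _).trans ?_
    rw [Polynomial.natDegree_sub_C]
    exact hdeg i
  have hw2 : ∀ i, w i * w i = 1 := fun i => by rcases hw i with h | h <;> rw [h] <;> norm_num
  have hgr : ∀ i a, ((Polynomial.C (w i) * (h i - Polynomial.C (c i))).eval (X a) - Z a) ^ 2 =
      r i a ^ 2 := fun i a => by
    simp only [Polynomial.eval_mul, Polynomial.eval_C, Polynomial.eval_sub, r]
    linear_combination (((h i).eval (X a) - c i) ^ 2 - Z a ^ 2) * hw2 i
  simp_rw [hgr]
  have hfL := memLp_two_mvPolynomial_eval_pi hX f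
  have hZL : MemLp (fun ω : ι → Ω => ∑ j, w j * Z (ω j)) 2 (Measure.pi fun _ => ν) :=
    memLp_finsetSum _ fun j _ => (memLp_two_comp_eval_pi hZ j).const_mul _
  have hGL : MemLp (fun ω : ι → Ω => MvPolynomial.eval (fun j => X (ω j)) f - ∑ j, w j * Z (ω j))
      2 (Measure.pi fun _ => ν) := hfL.sub hZL
  have hrL' := fun i : ι => memLp_two_comp_eval_pi (hrL i) i
  have hRL : MemLp (fun ω : ι → Ω => ∑ j, r j (ω j)) 2 (Measure.pi fun _ => ν) :=
    memLp_finsetSum _ fun j _ => hrL' j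
  -- the projection of the error onto the functions of the `i`-th coordinate is `r i`
  have hGr : ∀ i, ∫ ω : ι → Ω, (MvPolynomial.eval (fun j => X (ω j)) f - ∑ j, w j * Z (ω j)) *
      r i (ω i) ∂(Measure.pi fun _ => ν) = ∫ a, r i a ^ 2 ∂ν := fun i => by
    have hZr : ∀ j, Integrable (fun ω : ι → Ω => w j * Z (ω j) * r i (ω i))
        (Measure.pi fun _ => ν) := fun j =>
      ((memLp_two_comp_eval_pi hZ j).const_mul (w j)).integrable_fun_mul (hrL' i)
    have e1 : ∫ ω : ι → Ω, (∑ j, w j * Z (ω j)) * r i (ω i) ∂(Measure.pi fun _ => ν) =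
        ∫ a, w i * Z a * r i a ∂ν := by
      simp_rw [Finset.sum_mul]
      rw [integral_finsetSum _ fun j _ => hZr j, Finset.sum_eq_single i]
      · exact integral_comp_eval (μ := fun _ : ι => ν) (f := fun a => w i * Z a * r i a)
          ((hZ.const_mul (w i)).integrable_fun_mul (hrL i)).aestronglyMeasurable
      · intro j _ hji
        simp_rw [mul_assoc]
        rw [integral_const_mul, integral_comp_eval_mul_comp_eval_pi hZ.aestronglyMeasurable
          (hrL i).aestronglyMeasurable hji, hZ0]
        simp
      · simp
    simp_rw [sub_mul]
    rw [integral_sub (hfL.integrable_fun_mul (hrL' i)) (hZL.integrable_fun_mul (hrL' i)), e1,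
      hint i _ (hrL i), ← integral_sub ((hhL i).integrable_fun_mul (hrL i))
      ((hZ.const_mul (w i)).integrable_fun_mul (hrL i))]
    have e2 : ∀ a, (h i).eval (X a) * r i a - w i * Z a * r i a = r i a ^ 2 + c i * r i a :=
      fun a => by simp only [r]; ring
    simp_rw [e2]
    rw [integral_add (hrL i).integrable_sq (((hrL i).integrable one_le_two).const_mul _),
      integral_const_mul, hr0, mul_zero, add_zero]
  have hrr : ∀ i, ∫ ω : ι → Ω, (∑ j, r j (ω j)) * r i (ω i) ∂(Measure.pi fun _ => ν) =
      ∫ a, r i a ^ 2 ∂ν := fun i => by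
    simp_rw [Finset.sum_mul]
    rw [integral_finsetSum _ fun j _ => (hrL' j).integrable_fun_mul (hrL' i),
      Finset.sum_eq_single i]
    · simp_rw [← sq]
      exact integral_comp_eval (μ := fun _ : ι => ν) (f := fun a => r i a ^ 2)
        (hrL i).integrable_sq.aestronglyMeasurable
    · intro j _ hji
      rw [integral_comp_eval_mul_comp_eval_pi (hrL j).aestronglyMeasurable
        (hrL i).aestronglyMeasurable hji, hr0, zero_mul]
    · simp
  have hGR : ∫ ω : ι → Ω, (MvPolynomial.eval (fun j => X (ω j)) f - ∑ j, w j * Z (ω j)) *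
      ∑ i, r i (ω i) ∂(Measure.pi fun _ => ν) = ∑ i, ∫ a, r i a ^ 2 ∂ν := by
    simp_rw [Finset.mul_sum]
    rw [integral_finsetSum _ fun i _ => hGL.integrable_fun_mul (hrL' i)]
    exact Finset.sum_congr rfl fun i _ => hGr i
  have hRR : ∫ ω : ι → Ω, (∑ i, r i (ω i)) * ∑ i, r i (ω i) ∂(Measure.pi fun _ => ν) =
      ∑ i, ∫ a, r i a ^ 2 ∂ν := by
    conv_lhs =>
      enter [2, ω]
      rw [Finset.mul_sum]
    rw [integral_finsetSum _ fun i _ => hRL.integrable_fun_mul (hrL' i)]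
    exact Finset.sum_congr rfl fun i _ => hrr i
  -- `‖G‖² ≥ 2 ⟨G, R⟩ - ‖R‖²` for the error `G` and its projection `R`
  have hmono : ∫ ω : ι → Ω,
      (2 * ((MvPolynomial.eval (fun j => X (ω j)) f - ∑ j, w j * Z (ω j)) * ∑ i, r i (ω i)) -
        (∑ i, r i (ω i)) * ∑ i, r i (ω i)) ∂(Measure.pi fun _ => ν) ≤
      ∫ ω : ι → Ω, (MvPolynomial.eval (fun j => X (ω j)) f - ∑ j, w j * Z (ω j)) ^ 2
        ∂(Measure.pi fun _ => ν) :=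
    integral_mono (((hGL.integrable_fun_mul hRL).const_mul 2).sub (hRL.integrable_fun_mul hRL))
      hGL.integrable_sq fun ω => by
        beta_reduce
        nlinarith [sq_nonneg (MvPolynomial.eval (fun j => X (ω j)) f - ∑ j, w j * Z (ω j) -
          ∑ i, r i (ω i))]
  rw [integral_sub ((hGL.integrable_fun_mul hRL).const_mul 2) (hRL.integrable_fun_mul hRL),
    integral_const_mul] at hmono
  linarith

/-- Independent centred variables are orthogonal, so their second moments add up. -/
lemma integral_sum_mul_sq_pi [IsProbabilityMeasure ν] (hZ : MemLp Z 2 ν) (hZ0 : ∫ a, Z a ∂ν = 0)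
    {w : ι → ℝ} (hw : ∀ i, w i = 1 ∨ w i = -1) :
    ∫ ω : ι → Ω, (∑ j, w j * Z (ω j)) ^ 2 ∂(Measure.pi fun _ => ν) =
      Fintype.card ι * ∫ a, Z a ^ 2 ∂ν := by
  have hL : ∀ i : ι, MemLp (fun ω : ι → Ω => w i * Z (ω i)) 2 (Measure.pi fun _ => ν) := fun i =>
    (memLp_two_comp_eval_pi hZ i).const_mul (w i)
  simp_rw [sq, Finset.sum_mul_sum]
  rw [integral_finsetSum _ fun i _ => integrable_finsetSum _ fun j _ =>
    (hL i).integrable_fun_mul (hL j)]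
  have : ∀ i : ι, ∫ ω : ι → Ω, ∑ j, w i * Z (ω i) * (w j * Z (ω j)) ∂(Measure.pi fun _ => ν) =
      ∫ a, Z a * Z a ∂ν := fun i => by
    rw [integral_finsetSum _ fun j _ => (hL i).integrable_fun_mul (hL j), Finset.sum_eq_single i]
    · have hwi : ∀ z : ℝ, w i * z * (w i * z) = z * z := fun z => by
        rcases hw i with h | h <;> rw [h] <;> ring
      simp_rw [hwi]
      exact integral_comp_eval (μ := fun _ : ι => ν) (f := fun a => Z a * Z a)
        (hZ.integrable_fun_mul hZ).aestronglyMeasurable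
    · intro j _ hji
      rw [integral_comp_eval_mul_comp_eval_pi (φ := fun a => w i * Z a) (ψ := fun a => w j * Z a)
        (hZ.const_mul _).aestronglyMeasurable (hZ.const_mul _).aestronglyMeasurable hji.symm,
        integral_const_mul, hZ0]
      simp
    · simp
  simp_rw [this]
  simp

end ProductSpace

/-! ### Rotation invariance -/

lemma totalDegree_aeval_le_of_forall_le_one {σ τ : Type*} [Fintype σ]
    {l : σ → MvPolynomial τ ℝ} (hl : ∀ i, (l i).totalDegree ≤ 1) (f : MvPolynomial σ ℝ) :
    (MvPolynomial.aeval l f).totalDegree ≤ f.totalDegree := by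
  rw [MvPolynomial.aeval_def, MvPolynomial.eval₂_eq']
  refine MvPolynomial.totalDegree_finsetSum_le fun s hs => ?_
  refine (MvPolynomial.totalDegree_mul _ _).trans ?_
  rw [MvPolynomial.algebraMap_eq, MvPolynomial.totalDegree_C, zero_add]
  refine (MvPolynomial.totalDegree_finsetProd _ _).trans ?_
  refine le_trans ?_ (MvPolynomial.le_totalDegree hs)
  rw [Finsupp.sum_fintype _ _ fun _ => rfl]
  exact Finset.sum_le_sum fun i _ => (MvPolynomial.totalDegree_pow _ _).trans
    (by simpa using Nat.mul_le_mul_left (s i) (hl i))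

lemma exists_eval_mulVec {n : ℕ} (A : Matrix (Fin n) (Fin n) ℝ) (f : MvPolynomial (Fin n) ℝ) :
    ∃ f' : MvPolynomial (Fin n) ℝ, f'.totalDegree ≤ f.totalDegree ∧
      ∀ x, MvPolynomial.eval x f' = MvPolynomial.eval (A.mulVec x) f := by
  refine ⟨MvPolynomial.aeval
    (fun i => ∑ j, MvPolynomial.C (A i j) * MvPolynomial.X j : Fin n → MvPolynomial (Fin n) ℝ) f,
    totalDegree_aeval_le_of_forall_le_one (fun i => ?_) f, fun x => ?_⟩
  · refine MvPolynomial.totalDegree_finsetSum_le fun j _ =>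
      (MvPolynomial.totalDegree_mul _ _).trans ?_
    simp
  · rw [MvPolynomial.aeval_def, MvPolynomial.algebraMap_eq, MvPolynomial.eval₂_eq',
      MvPolynomial.eval_eq' (A.mulVec x)]
    simp [Matrix.mulVec, dotProduct]

/-- The law `N(0, v I)` is invariant under orthogonal matrices: its characteristic function depends
only on the Euclidean norm. -/
lemma measurePreserving_mulVec_gaussian {n : ℕ} {A : Matrix (Fin n) (Fin n) ℝ}
    (hA : A ∈ Matrix.orthogonalGroup (Fin n) ℝ) (v : ℝ≥0) :
    MeasurePreserving A.mulVec (Measure.pi fun _ : Fin n => gaussianReal 0 v)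
      (Measure.pi fun _ : Fin n => gaussianReal 0 v) := by
  have hmeas : Measurable A.mulVec := (Continuous.matrix_mulVec continuous_const
    continuous_id).measurable
  refine ⟨hmeas, ?_⟩
  set P := Measure.pi fun _ : Fin n => gaussianReal 0 v with hP
  have hto : Measurable (WithLp.toLp 2 : (Fin n → ℝ) → EuclideanSpace ℝ (Fin n)) :=
    (PiLp.continuous_toLp 2 _).measurable
  have hchar : ∀ t : EuclideanSpace ℝ (Fin n), charFun (P.map (WithLp.toLp 2)) t =
      Complex.exp (-(v * ∑ i, (t i : ℂ) ^ 2 / 2)) := fun t => by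
    rw [hP, charFun_pi]
    simp_rw [charFun_gaussianReal]
    rw [← Complex.exp_sum, Finset.mul_sum, ← Finset.sum_neg_distrib]
    congr 1
    refine Finset.sum_congr rfl fun i _ => ?_
    push_cast
    ring
  have key : (P.map A.mulVec).map (WithLp.toLp 2 : (Fin n → ℝ) → EuclideanSpace ℝ (Fin n)) =
      P.map (WithLp.toLp 2) := by
    have : IsProbabilityMeasure (P.map A.mulVec) := Measure.isProbabilityMeasure_map
      hmeas.aemeasurable
    have := Measure.isProbabilityMeasure_map (μ := P.map A.mulVec) hto.aemeasurable
    have := Measure.isProbabilityMeasure_map (μ := P) hto.aemeasurable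
    refine Measure.ext_of_charFun ?_
    ext t
    have e1 : charFun ((P.map A.mulVec).map (WithLp.toLp 2)) t =
        charFun (P.map (WithLp.toLp 2)) (WithLp.toLp 2 (A.transpose.mulVec t.ofLp)) := by
      rw [charFun_apply, charFun_apply, integral_map hto.aemeasurable (by fun_prop),
        integral_map hto.aemeasurable (by fun_prop), integral_map hmeas.aemeasurable]
      · congr 1 with x
        have : inner ℝ (WithLp.toLp 2 (A.mulVec x)) t =
            inner ℝ (WithLp.toLp 2 x) (WithLp.toLp 2 (A.transpose.mulVec t.ofLp)) := by
          simp only [EuclideanSpace.inner_eq_star_dotProduct, star_trivial]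
          rw [Matrix.dotProduct_mulVec, Matrix.mulVec_transpose]
        rw [this]
      · exact (Measurable.comp (g := fun y : EuclideanSpace ℝ (Fin n) =>
          Complex.exp (inner ℝ y t * Complex.I)) (by fun_prop) hto).aestronglyMeasurable
    have hAA : A * A.transpose = 1 := (Matrix.mem_orthogonalGroup_iff _ _).1 hA
    have e2 : ∑ i, (A.transpose.mulVec t.ofLp i) ^ 2 = ∑ i, t i ^ 2 := by
      have : dotProduct (A.transpose.mulVec t.ofLp) (A.transpose.mulVec t.ofLp) =
          dotProduct t.ofLp t.ofLp := by
        rw [Matrix.dotProduct_mulVec, Matrix.vecMul_transpose, Matrix.mulVec_mulVec, hAA,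
          Matrix.one_mulVec]
      simpa [dotProduct, sq] using this
    rw [e1, hchar, hchar]
    congr 2
    simp_rw [← Finset.sum_div]
    exact_mod_cast congrArg (fun x : ℝ => (v : ℂ) * ((x : ℂ) / 2)) e2
  have h2 := congrArg (fun m => m.map (WithLp.ofLp : EuclideanSpace ℝ (Fin n) → Fin n → ℝ)) key
  have hof : Measurable (WithLp.ofLp : EuclideanSpace ℝ (Fin n) → Fin n → ℝ) :=
    (PiLp.continuous_ofLp 2 _).measurable
  simp only [Measure.map_map hof hto] at h2
  have hid : (WithLp.ofLp : EuclideanSpace ℝ (Fin n) → Fin n → ℝ) ∘ WithLp.toLp 2 = id := rfl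
  rwa [hid, Measure.map_id, Measure.map_id] at h2

/-! ### The loss of a polynomial predictor -/

/-- The instance in rotated noise coordinates: the pairs `(Zᵢ, ξᵢ)` are independent, and
`(Z, A ξ)` has the law of `(Z, ξ)`. -/
lemma measurePreserving_instanceLaw {n : ℕ} {k γ σ : ℝ} [IsProbabilityMeasure (spikeLaw (k / n) γ)]
    {A : Matrix (Fin n) (Fin n) ℝ} (hA : A ∈ Matrix.orthogonalGroup (Fin n) ℝ) :
    MeasurePreserving
      (fun ω : Fin n → ℝ × ℝ => ((fun i => (ω i).1, A.mulVec fun i => (ω i).2) :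
        (Fin n → ℝ) × (Fin n → ℝ)))
      (Measure.pi fun _ => (spikeLaw (k / n) γ).prod (gaussianReal 0 (σ ^ 2).toNNReal))
      (instanceLaw n k γ σ) :=
  ((MeasurePreserving.id _).prod (measurePreserving_mulVec_gaussian hA _)).comp
    (measurePreserving_arrowProdEquivProdArrow ℝ ℝ (Fin n) (fun _ => spikeLaw (k / n) γ)
      (fun _ => gaussianReal 0 (σ ^ 2).toNNReal))

lemma continuous_sqError {n : ℕ} (A : Matrix (Fin n) (Fin n) ℝ) (w : Fin n → ℝ)
    (f : MvPolynomial (Fin n) ℝ) : Continuous (sqError A w f) := by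
  have h1 : Continuous (obsX A) :=
    (Continuous.matrix_mulVec continuous_const continuous_fst).add continuous_snd
  have h2 : Continuous (targetY w) := by unfold targetY; fun_prop
  exact (((MvPolynomial.continuous_eval f).comp h1).sub h2).pow 2

/-- In rotated coordinates `X = A (Z + ξ)`, so a polynomial in `X` is a polynomial of no larger
degree in `Z + ξ`. -/
lemma sqError_rotate {n : ℕ} (A : Matrix (Fin n) (Fin n) ℝ) (w : Fin n → ℝ)
    {f f' : MvPolynomial (Fin n) ℝ}
    (hf' : ∀ x, MvPolynomial.eval x f' = MvPolynomial.eval (A.mulVec x) f) (ω : Fin n → ℝ × ℝ) :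
    sqError A w f (fun i => (ω i).1, A.mulVec fun i => (ω i).2) =
      (MvPolynomial.eval (fun j => (ω j).1 + (ω j).2) f' - ∑ j, w j * (ω j).1) ^ 2 := by
  rw [hf', sqError, targetY, obsX, ← Matrix.mulVec_add]
  rfl

section Loss

variable {n : ℕ} {k γ σ : ℝ} {A : Matrix (Fin n) (Fin n) ℝ} {w : Fin n → ℝ}

lemma sparsity_ratio_mem (hk : 0 ≤ k) (hkn : k < (n : ℝ) / 2) : 0 ≤ k / n ∧ k / n ≤ 1 / 2 := by
  have hn : (0 : ℝ) < n := by linarith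
  exact ⟨by positivity, by rw [div_le_iff₀ hn]; linarith⟩

lemma memLp_fst_spikeLaw_prod {p : ℝ} [IsProbabilityMeasure (spikeLaw p γ)] (v : ℝ≥0) :
    MemLp (fun a : ℝ × ℝ => a.1) 2 ((spikeLaw p γ).prod (gaussianReal 0 v)) := by
  simpa using memLp_two_polynomial_eval (μ := (spikeLaw p γ).prod (gaussianReal 0 v))
    (X := fun q : ℝ × ℝ => q.1) (fun m => (integrable_pow_spikeLaw p γ m).comp_fst _) Polynomial.X

lemma integral_fst_spikeLaw_prod {p : ℝ} [IsProbabilityMeasure (spikeLaw p γ)] (v : ℝ≥0) :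
    ∫ a : ℝ × ℝ, a.1 ∂(spikeLaw p γ).prod (gaussianReal 0 v) = 0 := by
  rw [integral_fun_fst (fun x : ℝ => x), integral_id_spikeLaw, smul_zero]

/-- The polynomial lower bound: after the rotation, tensorization reduces it to `n` copies of the
scalar bound. -/
lemma integrable_sqError_and_le_sqLoss (hk : 0 ≤ k) (hkn : k < (n : ℝ) / 2) (hγ : 0 ≤ γ)
    (hσ : 0 < σ) (hA : A ∈ Matrix.orthogonalGroup (Fin n) ℝ) (hw : ∀ i, w i = 1 ∨ w i = -1)
    {d : ℕ} {f : MvPolynomial (Fin n) ℝ} (hf : f.totalDegree ≤ d) :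
    Integrable (sqError A w f) (instanceLaw n k γ σ) ∧
      (1 / 4 : ℝ) * (γ ^ 2 * k /
        (1 + √(k / n) * ((d : ℝ) + 1) ^ (3 * d + 2) * (1 + (γ / σ) ^ d)) ^ 2)
        ≤ sqLoss k γ σ A w f := by
  obtain ⟨hp0, hp1⟩ := sparsity_ratio_mem hk hkn
  have hn : (0 : ℝ) < n := by linarith
  have := isProbabilityMeasure_spikeLaw hp0 (by linarith) γ
  have hΦ := measurePreserving_instanceLaw (k := k) (γ := γ) (σ := σ) hA
  have hmeas : AEStronglyMeasurable (sqError A w f) (instanceLaw n k γ σ) :=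
    (continuous_sqError A w f).measurable.aestronglyMeasurable
  obtain ⟨f', hf'deg, hf'⟩ := exists_eval_mulVec A f
  set v := (σ ^ 2).toNNReal
  have hX := integrable_add_pow_prod (integrable_pow_spikeLaw (k / n) γ)
    (integrable_pow_gaussianReal v)
  have hZ := memLp_fst_spikeLaw_prod (γ := γ) (p := k / n) v
  constructor
  · rw [← hΦ.integrable_comp hmeas]
    have h1 := memLp_two_mvPolynomial_eval_pi hX f'
    have h2 : MemLp (fun ω : Fin n → ℝ × ℝ => ∑ j, w j * (ω j).1) 2
        (Measure.pi fun _ => (spikeLaw (k / n) γ).prod (gaussianReal 0 v)) :=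
      memLp_finsetSum _ fun j _ => (memLp_two_comp_eval_pi hZ j).const_mul _
    exact (h1.sub h2).integrable_sq.congr
      (ae_of_all _ fun ω => (sqError_rotate A w hf' ω).symm)
  · obtain ⟨g, hgdeg, hg⟩ := exists_sum_scalar_loss_le hX hZ
      (integral_fst_spikeLaw_prod v) hw f'
    refine (le_trans ?_ hg).trans_eq ?_
    swap
    · rw [sqLoss, ← hΦ.map_eq, integral_map hΦ.measurable.aemeasurable (by rwa [hΦ.map_eq])]
      simp_rw [sqError_rotate A w hf']
    have hscal := Finset.card_nsmul_le_sum Finset.univ _ _ fun i _ =>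
      scalar_loss_ge (γ := γ) hp0 hp1 hγ hσ ((hgdeg i).trans (hf'deg.trans hf))
    refine le_trans (le_of_eq ?_) hscal
    rw [Finset.card_univ, Fintype.card_fin, nsmul_eq_mul]
    field_simp

lemma sqLoss_zero (hk : 0 ≤ k) (hkn : k < (n : ℝ) / 2)
    (hA : A ∈ Matrix.orthogonalGroup (Fin n) ℝ) (hw : ∀ i, w i = 1 ∨ w i = -1) :
    sqLoss k γ σ A w 0 = γ ^ 2 * k := by
  obtain ⟨hp0, hp1⟩ := sparsity_ratio_mem hk hkn
  have hn : (0 : ℝ) < n := by linarith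
  have := isProbabilityMeasure_spikeLaw hp0 (by linarith) γ
  have hΦ := measurePreserving_instanceLaw (k := k) (γ := γ) (σ := σ) hA
  have hmeas : AEStronglyMeasurable (sqError A w 0) (instanceLaw n k γ σ) :=
    (continuous_sqError A w 0).measurable.aestronglyMeasurable
  rw [sqLoss, ← hΦ.map_eq, integral_map hΦ.measurable.aemeasurable (by rwa [hΦ.map_eq])]
  simp_rw [sqError_rotate A w (f := 0) (f' := 0) (by simp), map_zero, zero_sub, neg_sq]
  rw [integral_sum_mul_sq_pi (memLp_fst_spikeLaw_prod _) (integral_fst_spikeLaw_prod _) hw,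
    integral_fun_fst (fun x : ℝ => x ^ 2), integral_sq_spikeLaw hp0]
  simp
  field_simp

end Loss

/-! ### The asymptotic regime -/

/-- If `d = o(log n / log log n)` and the signal-to-noise ratio `ρ` is polylogarithmic, the factor
`(d + 1) ^ (3 d + 2) (1 + ρ ^ d)` is `n ^ o(1)`; a sparsity of at most `n ^ (1 - ε)` makes `√(k / n)`
at most `n ^ (-ε / 2)`, which wins. -/
lemma tendsto_loss_factor {d : ℕ → ℕ} {k ρ : ℕ → ℝ} {ε c : ℝ} (hε : 0 < ε)
    (hk : ∀ n, 0 ≤ k n) (hρ : ∀ n, 0 ≤ ρ n) (hkn : ∀ᶠ n : ℕ in atTop, k n ≤ (n : ℝ) ^ (1 - ε))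
    (hρn : ∀ᶠ n : ℕ in atTop, ρ n ≤ Real.log n ^ c)
    (hd : (fun n => (d n : ℝ)) =o[atTop] (fun n : ℕ => Real.log n / Real.log (Real.log n))) :
    Tendsto (fun n => √(k n / n) * ((d n : ℝ) + 1) ^ (3 * d n + 2) * (1 + ρ n ^ d n))
      atTop (𝓝 0) := by
  have hL : Tendsto (fun n : ℕ => Real.log n) atTop atTop :=
    Real.tendsto_log_atTop.comp tendsto_natCast_atTop_atTop
  have hl : Tendsto (fun n : ℕ => Real.log (Real.log n)) atTop atTop :=
    Real.tendsto_log_atTop.comp hL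
  have hlL : (fun n : ℕ => Real.log (Real.log n)) =o[atTop] (fun n : ℕ => Real.log n) :=
    Real.isLittleO_log_id_atTop.comp_tendsto hL
  -- up to `2 log log n` and a factor `2`, the logarithm of the degree-dependent part is at most
  -- `C d log log n`
  set C : ℝ := 3 + |c| with hC
  have hC0 : 0 < C := by positivity
  have hbound : Tendsto (fun n : ℕ => 2 * Real.exp (-(ε / 4) * Real.log n)) atTop (𝓝 0) := by
    have h1 : Tendsto (fun n : ℕ => -(ε / 4) * Real.log n) atTop atBot :=
      hL.const_mul_atTop_of_neg (by linarith)
    simpa using (Real.tendsto_exp_atBot.comp h1).const_mul 2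
  refine tendsto_of_tendsto_of_tendsto_of_le_of_le' tendsto_const_nhds hbound
    (Eventually.of_forall fun n => ?_) ?_
  · have := hρ n; have := hk n; positivity
  filter_upwards [hkn, hρn, hd.bound (c := min 1 (ε / (8 * C))) (by positivity),
    hlL.bound (c := ε / 16) (by positivity), hL.eventually_ge_atTop 1, hl.eventually_ge_atTop 2,
    eventually_gt_atTop 0] with n h1 h2 h3 h4 h5 h6 h7
  have hn : (0 : ℝ) < n := by exact_mod_cast h7
  set L := Real.log n with hLdef
  set l := Real.log L with hldef
  have hLpos : 0 < L := by linarith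
  have hlpos : 0 < l := by linarith
  rw [Real.norm_of_nonneg (by positivity), Real.norm_of_nonneg (by positivity)] at h3
  rw [Real.norm_of_nonneg hlpos.le, Real.norm_of_nonneg hLpos.le] at h4
  have hexpl : Real.exp l = L := Real.exp_log hLpos
  have hd1 : (d n : ℝ) + 1 ≤ L := by
    have h8 : (d n : ℝ) ≤ L / l :=
      h3.trans (mul_le_of_le_one_left (by positivity) (min_le_left _ _))
    have h9 : L / l ≤ L / 2 := by gcongr
    have h10 : 2 ≤ L := h6.trans (Real.log_le_self hLpos.le)
    linarith
  have hdl : C * (d n * l) ≤ ε / 8 * L := by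
    have h8 : (d n : ℝ) ≤ ε / (8 * C) * (L / l) :=
      h3.trans (mul_le_mul_of_nonneg_right (min_le_right _ _) (by positivity))
    calc C * (d n * l) ≤ C * (ε / (8 * C) * (L / l) * l) := by gcongr
      _ = ε / 8 * L := by field_simp
  have e1 : √(k n / n) ≤ Real.exp (-(ε / 2) * L) := by
    rw [Real.sqrt_le_left (Real.exp_pos _).le, ← Real.exp_nat_mul, div_le_iff₀ hn]
    refine h1.trans (le_of_eq ?_)
    rw [Real.rpow_def_of_pos hn]
    rw [← hLdef, ← Real.exp_log hn, ← Real.exp_add]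
    congr 1
    push_cast
    ring
  have e2 : ((d n : ℝ) + 1) ^ (3 * d n + 2) ≤ Real.exp ((3 * d n + 2) * l) := by
    calc ((d n : ℝ) + 1) ^ (3 * d n + 2) ≤ L ^ (3 * d n + 2) := by gcongr
      _ = Real.exp ((3 * d n + 2) * l) := by
        rw [← hexpl, ← Real.exp_nat_mul]
        push_cast
        rfl
  have e3 : 1 + ρ n ^ d n ≤ 2 * Real.exp (|c| * (d n * l)) := by
    have hρ1 : ρ n ≤ Real.exp (|c| * l) := by
      refine h2.trans ?_
      rw [Real.rpow_def_of_pos hLpos, ← hldef, mul_comm]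
      exact Real.exp_le_exp.2 (mul_le_mul_of_nonneg_right (le_abs_self c) hlpos.le)
    have h8 : ρ n ^ d n ≤ Real.exp (|c| * (d n * l)) := by
      calc ρ n ^ d n ≤ Real.exp (|c| * l) ^ d n := pow_le_pow_left₀ (hρ n) hρ1 _
        _ = _ := by rw [← Real.exp_nat_mul]; ring_nf
    have h9 : 1 ≤ Real.exp (|c| * (d n * l)) := Real.one_le_exp (by positivity)
    linarith
  calc √(k n / n) * ((d n : ℝ) + 1) ^ (3 * d n + 2) * (1 + ρ n ^ d n)
      ≤ Real.exp (-(ε / 2) * L) * Real.exp ((3 * d n + 2) * l) *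
          (2 * Real.exp (|c| * (d n * l))) := by
        gcongr
        have := hρ n; positivity
    _ = 2 * Real.exp (-(ε / 2) * L + (C * (d n * l) + 2 * l)) := by
        rw [mul_left_comm, ← Real.exp_add, ← Real.exp_add, hC]
        ring_nf
    _ ≤ 2 * Real.exp (-(ε / 4) * L) := by
        gcongr
        linarith

theorem mainTheorem1 :
    -- the bound for polynomials of degree at most `d`, in every dimension `n`
    (∀ (n d : ℕ) (k γ σ : ℝ), 0 ≤ k → k < (n : ℝ) / 2 → 0 ≤ γ → 0 < σ →
      ∀ A ∈ Matrix.orthogonalGroup (Fin n) ℝ, ∀ w : Fin n → ℝ, (∀ i, w i = 1 ∨ w i = -1) →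
        ∀ f : MvPolynomial (Fin n) ℝ, f.totalDegree ≤ d →
          Integrable (sqError A w f) (instanceLaw n k γ σ) ∧
          (1 / 4 : ℝ) * (γ ^ 2 * k /
            (1 + √(k / n) * ((d : ℝ) + 1) ^ (3 * d + 2) * (1 + (γ / σ) ^ d)) ^ 2)
            ≤ sqLoss k γ σ A w f) ∧
    -- the error of the trivial zero estimator
    (∀ (n : ℕ) (k γ σ : ℝ), 0 ≤ k → k < (n : ℝ) / 2 → 0 ≤ γ → 0 < σ →
      ∀ A ∈ Matrix.orthogonalGroup (Fin n) ℝ, ∀ w : Fin n → ℝ, (∀ i, w i = 1 ∨ w i = -1) →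
        sqLoss k γ σ A w 0 = γ ^ 2 * k) ∧
    -- degree `o(log n / log log n)` does no better, up to a constant factor
    (∀ (d : ℕ → ℕ) (k γ σ : ℕ → ℝ) (ε c : ℝ), 0 < ε →
      (∀ n, 0 ≤ k n) → (∀ n, 0 ≤ γ n) → (∀ n, 0 < σ n) →
      (∀ᶠ n : ℕ in atTop, k n ≤ (n : ℝ) ^ (1 - ε)) →
      (∀ᶠ n : ℕ in atTop, γ n / σ n ≤ Real.log n ^ c) →
      (fun n => (d n : ℝ)) =o[atTop] (fun n : ℕ => Real.log n / Real.log (Real.log n)) →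
      ∀ η : ℝ, 0 < η → ∀ᶠ n : ℕ in atTop,
        ∀ A ∈ Matrix.orthogonalGroup (Fin n) ℝ, ∀ w : Fin n → ℝ, (∀ i, w i = 1 ∨ w i = -1) →
          ∀ f : MvPolynomial (Fin n) ℝ, f.totalDegree ≤ d n →
            (1 / 4 - η) * sqLoss (k n) (γ n) (σ n) A w 0 ≤ sqLoss (k n) (γ n) (σ n) A w f) := by
  refine ⟨fun n d k γ σ hk hkn hγ hσ A hA w hw f hf =>
      integrable_sqError_and_le_sqLoss hk hkn hγ hσ hA hw hf,
    fun n k γ σ hk hkn _ _ A hA w hw => sqLoss_zero hk hkn hA hw,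
    fun d k γ σ ε c hε hk hγ hσ hkn hρn hd η hη => ?_⟩
  have ht := tendsto_loss_factor hε hk (ρ := fun n => γ n / σ n)
    (fun n => div_nonneg (hγ n) (hσ n).le) hkn hρn hd
  have hfac := (((ht.const_add 1).pow 2).inv₀ (by norm_num)).const_mul (1 / 4)
  have hlt : (1 / 4 - η : ℝ) < 1 / 4 * ((1 + 0) ^ 2)⁻¹ := by norm_num; exact hη
  have hhalf : ∀ᶠ n : ℕ in atTop, k n < (n : ℝ) / 2 := by
    have h1 : Tendsto (fun n : ℕ => (n : ℝ) ^ (-ε)) atTop (𝓝 0) :=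
      (tendsto_rpow_neg_atTop hε).comp tendsto_natCast_atTop_atTop
    filter_upwards [hkn, h1.eventually_lt_const (show (0 : ℝ) < 1 / 2 by norm_num),
      eventually_gt_atTop 0] with n h2 h3 h4
    have hn : (0 : ℝ) < n := by exact_mod_cast h4
    refine h2.trans_lt ?_
    rw [sub_eq_add_neg, Real.rpow_add hn, Real.rpow_one]
    nlinarith
  filter_upwards [hfac.eventually_const_lt hlt, hhalf] with n h1 h2 A hA w hw f hf
  rw [sqLoss_zero (hk n) h2 hA hw]
  refine le_trans ?_ (integrable_sqError_and_le_sqLoss (hk n) h2 (hγ n) (hσ n) hA hw hf).2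
  have h3 : 0 ≤ γ n ^ 2 * k n := mul_nonneg (sq_nonneg _) (hk n)
  refine (mul_le_mul_of_nonneg_right h1.le h3).trans (le_of_eq ?_)
  ring
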